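/- Let $(A,B)\in\mathbb{C}^{n\times n}\times\mathbb{C}^{n\times m}$ be a controllable pair, i.e. the matrix $[\,B\ \ AB\ \cdots\ A^{n-1}B\,]$ has rank $n$, and for $T>0$ let $$W_{A,B}(T)=\int_0^T e^{-At}BB^\dagger e^{-A^\dagger t}\,\mathrm{d}t .$$ Let $P\in\mathbb{C}^{n\times n}$ be a nonsingular matrix such that $$P^{-1}AP=\begin{bmatrix}J_{\mathsf u}&0\\0&J_{\mathsf s}\end{bmatrix}$$ is in Jordan normal form, where the eigenvalues of $J_{\mathsf u}\in\mathbb{C}^{n_{\mathsf u}\times n_{\mathsf u}}$ have positive real parts and those of $J_{\mathsf s}\in\mathbb{C}^{n_{\mathsf s}\times n_{\mathsf s}}$ have non-positive real parts, with $n_{\mathsf u}+n_{\mathsf s}=n$. Let $C_{\mathsf u}\in\mathbb{C}^{n_{\mathsf u}\times m}$ consist of the first $n_{\mathsf u}$ rows of $P^{-1}B$, and let $$W_{\mathsf u}=\int_0^\infty e^{-J_{\mathsf u}t}C_{\mathsf u}C_{\mathsf u}^\dagger e^{-J_{\mathsf u}^\dagger t}\,\mathrm{d}t,\qquad K=(P^{-1})^\dagger\begin{bmatrix}W_{\mathsf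 u}^{-1}&0\\0&0\end{bmatrix}P^{-1}.$$ Then $W_{A,B}(T)$ is invertible for every $T>0$, the integral defining $W_{\mathsf u}$ converges, $W_{\mathsf u}$ is invertible, and $$\lim_{T\to\infty}W_{A,B}(T)^{-1}=K .$$ -/

import Mathlib

open MeasureTheory Filter Topology Matrix

noncomputable section

/-- The controllability matrix `[B  AB  ⋯  A^(n-1) B]`; its columns are indexed by pairs `(k, j)`,
the column `(k, j)` being the `j`-th column of `A ^ k * B`. -/
def controllabilityMatrix {n m : ℕ} (A : Matrix (Fin n) (Fin n) ℂ) (B : Matrix (Fin n) (Fin m) ℂ) :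
    Matrix (Fin n) (Fin n × Fin m) ℂ :=
  Matrix.of fun i kj => (A ^ (kj.1 : ℕ) * B) i kj.2

/-- The pair `(A, B)` is controllable if its controllability matrix has full rank `n`. -/
def IsControllable {n m : ℕ} (A : Matrix (Fin n) (Fin n) ℂ) (B : Matrix (Fin n) (Fin m) ℂ) : Prop :=
  (controllabilityMatrix A B).rank = n

/-- The integrand `e^{-At} B B† e^{-A† t}` of the controllability Gramian. -/
def gramianIntegrand {n m : ℕ} (A : Matrix (Fin n) (Fin n) ℂ) (B : Matrix (Fin n) (Fin m) ℂ)
    (t : ℝ) : Matrix (Fin n) (Fin n) ℂ :=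
  NormedSpace.exp (-(t • A)) * B * Bᴴ * NormedSpace.exp (-(t • Aᴴ))

/-- The controllability Gramian `W_{A,B}(T)`, integrated entrywise over `[0, T]`. -/
def gramian {n m : ℕ} (A : Matrix (Fin n) (Fin n) ℂ) (B : Matrix (Fin n) (Fin m) ℂ)
    (T : ℝ) : Matrix (Fin n) (Fin n) ℂ :=
  Matrix.of fun i j => ∫ t in (0 : ℝ)..T, gramianIntegrand A B t i j

/-- The infinite-horizon Gramian `W_{A,B}(∞)`, integrated entrywise over `(0, ∞)`. -/
def gramianInfty {n m : ℕ} (A : Matrix (Fin n) (Fin n) ℂ) (B : Matrix (Fin n) (Fin m) ℂ) :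
    Matrix (Fin n) (Fin n) ℂ :=
  Matrix.of fun i j => ∫ t in Set.Ioi (0 : ℝ), gramianIntegrand A B t i j

/-- The matrix `J` is in Jordan normal form, i.e. a block diagonal matrix whose diagonal blocks are
Jordan blocks (constant diagonal, ones on the superdiagonal, zeros elsewhere). Entrywise: `J` vanishes
off the diagonal and the superdiagonal, every superdiagonal entry is `0` (a block ends there) or `1`
(the block goes on), and in the latter case the two neighbouring diagonal entries agree. -/
def IsJordanNormalForm {n : ℕ} (J : Matrix (Fin n) (Fin n) ℂ) : Prop :=
  (∀ i j : Fin n, j ≠ i → (j : ℕ) ≠ (i : ℕ) + 1 → J i j = 0) ∧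
  (∀ i j : Fin n, (j : ℕ) = (i : ℕ) + 1 → J i j = 0 ∨ (J i j = 1 ∧ J i i = J j j))

/-- Splitting `Fin n` into the first `p` and the last `q` indices, where `p + q = n`. -/
def splitEquiv {p q n : ℕ} (h : p + q = n) : Fin p ⊕ Fin q ≃ Fin n :=
  finSumFinEquiv.trans (finCongr h)

/-- The block diagonal matrix `diag(X, Y)` of size `n = p + q`. -/
def blockDiag₂ {p q n : ℕ} (h : p + q = n) (X : Matrix (Fin p) (Fin p) ℂ)
    (Y : Matrix (Fin q) (Fin q) ℂ) : Matrix (Fin n) (Fin n) ℂ :=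
  Matrix.reindex (splitEquiv h) (splitEquiv h) (Matrix.fromBlocks X 0 0 Y)

/-- The first `p` rows of a matrix with `n = p + q` rows. -/
def topRows {p q n m : ℕ} (h : p + q = n) (C : Matrix (Fin n) (Fin m) ℂ) :
    Matrix (Fin p) (Fin m) ℂ :=
  C.submatrix (fun i => splitEquiv h (Sum.inl i)) id

/-- `P` is a change of basis that brings `A` to a Jordan normal form `diag(Ju, Js)` in which the
eigenvalues of `Ju` have positive and those of `Js` non-positive real parts. -/
structure IsJordanSplitting {n nu ns : ℕ} (h : nu + ns = n) (A P : Matrix (Fin n) (Fin n) ℂ)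
    (Ju : Matrix (Fin nu) (Fin nu) ℂ) (Js : Matrix (Fin ns) (Fin ns) ℂ) : Prop where
  nonsingular : IsUnit P
  conj_eq : P⁻¹ * A * P = blockDiag₂ h Ju Js
  jordan : IsJordanNormalForm (blockDiag₂ h Ju Js)
  unstable : ∀ μ ∈ spectrum ℂ Ju, 0 < μ.re
  nonpos : ∀ μ ∈ spectrum ℂ Js, μ.re ≤ 0

/-- `W_u = W_{J_u, C_u}(∞)`, where `C_u` consists of the first `nu` rows of `C = P⁻¹ B`. -/
def unstableGramian {n nu ns m : ℕ} (h : nu + ns = n) (P : Matrix (Fin n) (Fin n) ℂ)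
    (Ju : Matrix (Fin nu) (Fin nu) ℂ) (B : Matrix (Fin n) (Fin m) ℂ) :
    Matrix (Fin nu) (Fin nu) ℂ :=
  gramianInfty Ju (topRows h (P⁻¹ * B))

/-- The matrix `K = (P⁻¹)† diag(W_u⁻¹, 0) P⁻¹`. -/
def limitK {n nu ns m : ℕ} (h : nu + ns = n) (P : Matrix (Fin n) (Fin n) ℂ)
    (Ju : Matrix (Fin nu) (Fin nu) ℂ) (B : Matrix (Fin n) (Fin m) ℂ) :
    Matrix (Fin n) (Fin n) ℂ :=
  (P⁻¹)ᴴ * blockDiag₂ h (unstableGramian h P Ju B)⁻¹ 0 * P⁻¹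

end

/-! Write `W(T)` for `gramian A B T`. Controllability makes `W(T)` positive definite, and `W(T)`
grows with `T`, so the inverses decrease in the Loewner order and converge to some `L ≥ 0`
(`exists_tendsto_inv_gramian`). It remains to identify `L`.

The semigroup law `gramian_add`, multiplied out and passed to the limit, gives `L (W(τ) M + 1) = M`
with `M = e^{τA†} L e^{τA}` (`limit_inv_gramian_eq`). Its derivative at `τ = 0` is the Riccati
equation `L B B† L = L A + A† L` (`riccati`). Let `A v = c v + w` with `L w = 0` and `Re c ≤ 0`.
Pairing the equation with `v` gives `‖B† L v‖² = 2 Re(c) v† L v ≤ 0`; then `L v` is an eigenvector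
of `A†` killed by `B†`, so `L v = 0` by the Hautus test. Going up the Jordan chains, `L` vanishes on
the last `ns` columns of `P`.

Hence `L = R† Lu R`, with `R` the first `nu` rows of `P⁻¹` and `Lu` the compression of `L` to the
first `nu` columns of `P`. Completing the square shows that `Lu` is invertible, and the compressed
fixed-point equation reads `W_u(τ) + e^{-τJu} Lu⁻¹ e^{-τJu†} = Lu⁻¹`, where `W_u(τ)` is the Gramian
of the quotient pair. Since `e^{-τJu} → 0`, letting `τ → ∞` gives `W_u = Lu⁻¹`
(`compression_limit_inv_gramian`). -/

/-! ### Matrix exponentials along a real parameter. -/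

section Exponential

variable {n m : ℕ}

lemma Matrix.exp_add_smul (A : Matrix (Fin n) (Fin n) ℂ) (s t : ℝ) :
    NormedSpace.exp ((s + t) • A) = NormedSpace.exp (s • A) * NormedSpace.exp (t • A) := by
  rw [add_smul]
  exact Matrix.exp_add_of_commute _ _ (((Commute.refl A).smul_left s).smul_right t)

lemma Matrix.exp_smul_mul_exp_neg_smul (A : Matrix (Fin n) (Fin n) ℂ) (t : ℝ) :
    NormedSpace.exp (t • A) * NormedSpace.exp (-(t • A)) = 1 := by
  rw [← neg_smul, ← Matrix.exp_add_smul]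
  simp [NormedSpace.exp_zero]

lemma Matrix.exp_neg_smul_mul_exp_smul (A : Matrix (Fin n) (Fin n) ℂ) (t : ℝ) :
    NormedSpace.exp (-(t • A)) * NormedSpace.exp (t • A) = 1 := by
  rw [← neg_smul, ← Matrix.exp_add_smul]
  simp [NormedSpace.exp_zero]

/-- A linear functional of `exp (t A)` is differentiable in `t`. -/
lemma Matrix.hasDerivAt_map_exp_smul (A : Matrix (Fin n) (Fin n) ℂ)
    (φ : Matrix (Fin n) (Fin n) ℂ →ₗ[ℝ] ℂ) (t : ℝ) :
    HasDerivAt (fun s : ℝ => φ (NormedSpace.exp (s • A)))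
      (φ (NormedSpace.exp (t • A) * A)) t := by
  -- The norm serves the proof only; it induces the entrywise topology.
  let _ : NormedRing (Matrix (Fin n) (Fin n) ℂ) := Matrix.linftyOpNormedRing
  let _ : NormedAlgebra ℝ (Matrix (Fin n) (Fin n) ℂ) := Matrix.linftyOpNormedAlgebra
  have h := hasDerivAt_exp_smul_const (𝕂 := ℝ) A t
  exact (LinearMap.toContinuousLinearMap φ).hasFDerivAt.comp_hasDerivAt t h

lemma Matrix.hasSum_exp_smul (A : Matrix (Fin n) (Fin n) ℂ) (t : ℝ) :
    HasSum (fun k : ℕ => ((k.factorial : ℝ)⁻¹ * t ^ k) • A ^ k) (NormedSpace.exp (t • A)) := by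
  let _ : NormedRing (Matrix (Fin n) (Fin n) ℂ) := Matrix.linftyOpNormedRing
  let _ : NormedAlgebra ℝ (Matrix (Fin n) (Fin n) ℂ) := Matrix.linftyOpNormedAlgebra
  have h := NormedSpace.exp_series_hasSum_exp' (𝕂 := ℝ) (t • A)
  simp only [smul_pow, smul_smul] at h
  exact h

/-- If `R` intertwines `A` and `J`, it intertwines their exponentials. -/
lemma Matrix.mul_exp_smul_eq {R : Matrix (Fin m) (Fin n) ℂ} {A : Matrix (Fin n) (Fin n) ℂ}
    {J : Matrix (Fin m) (Fin m) ℂ} (h : R * A = J * R) (t : ℝ) :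
    R * NormedSpace.exp (t • A) = NormedSpace.exp (t • J) * R := by
  have hpow : ∀ k : ℕ, R * A ^ k = J ^ k * R := by
    intro k
    induction k with
    | zero => simp
    | succ k ih => rw [pow_succ, ← Matrix.mul_assoc, ih, Matrix.mul_assoc, h, ← Matrix.mul_assoc,
        ← pow_succ]
  have h1 := (Matrix.hasSum_exp_smul A t).map
    (⟨⟨fun M => R * M, Matrix.mul_zero R⟩, Matrix.mul_add R⟩ :
      Matrix (Fin n) (Fin n) ℂ →+ Matrix (Fin m) (Fin n) ℂ)
    (continuous_const.matrix_mul continuous_id)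
  have h2 := (Matrix.hasSum_exp_smul J t).map
    (⟨⟨fun M => M * R, Matrix.zero_mul R⟩, fun M N => Matrix.add_mul M N R⟩ :
      Matrix (Fin m) (Fin m) ℂ →+ Matrix (Fin m) (Fin n) ℂ)
    (continuous_id.matrix_mul continuous_const)
  refine h1.unique ?_
  refine h2.congr_fun ?_
  intro k
  simp [hpow]

lemma Matrix.continuous_exp_smul (A : Matrix (Fin n) (Fin n) ℂ) :
    Continuous fun t : ℝ => NormedSpace.exp (t • A) := by
  refine continuous_matrix fun i j => continuous_iff_continuousAt.2 fun t => ?_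
  exact (Matrix.hasDerivAt_map_exp_smul A (Matrix.entryLinearMap ℝ ℂ i j) t).continuousAt

lemma Matrix.continuous_exp_neg_smul (A : Matrix (Fin n) (Fin n) ℂ) :
    Continuous fun t : ℝ => NormedSpace.exp (-(t • A)) := by
  simpa only [smul_neg] using Matrix.continuous_exp_smul (-A)

lemma Matrix.conjTranspose_exp_neg_smul (A : Matrix (Fin n) (Fin n) ℂ) (t : ℝ) :
    (NormedSpace.exp (-(t • A)))ᴴ = NormedSpace.exp (-(t • Aᴴ)) := by
  rw [← Matrix.exp_conjTranspose]
  simp [Matrix.conjTranspose_smul]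

/-- The difference quotient of `exp (t A)` at `0` tends to `A`. -/
lemma Matrix.tendsto_slope_exp_smul (A : Matrix (Fin n) (Fin n) ℂ) :
    Tendsto (fun t : ℝ => t⁻¹ • (NormedSpace.exp (t • A) - 1)) (𝓝[≠] 0) (𝓝 A) := by
  refine tendsto_pi_nhds.2 fun i => tendsto_pi_nhds.2 fun j => ?_
  have h := (Matrix.hasDerivAt_map_exp_smul A (Matrix.entryLinearMap ℝ ℂ i j) 0).tendsto_slope_zero
  simpa [NormedSpace.exp_zero] using h

end Exponential

/-! ### Algebra and monotonicity of the finite-horizon Gramian. -/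

section Gramian

variable {n m : ℕ}

/-- The form `C C†` makes Hermitian symmetry and positivity visible. -/
lemma gramianIntegrand_eq (A : Matrix (Fin n) (Fin n) ℂ) (B : Matrix (Fin n) (Fin m) ℂ) (t : ℝ) :
    gramianIntegrand A B t =
      (NormedSpace.exp (-(t • A)) * B) * (NormedSpace.exp (-(t • A)) * B)ᴴ := by
  rw [Matrix.conjTranspose_mul, Matrix.conjTranspose_exp_neg_smul, gramianIntegrand]
  simp only [Matrix.mul_assoc]

lemma continuous_gramianIntegrand (A : Matrix (Fin n) (Fin n) ℂ) (B : Matrix (Fin n) (Fin m) ℂ) :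
    Continuous (gramianIntegrand A B) := by
  unfold gramianIntegrand
  exact (((Matrix.continuous_exp_neg_smul A).matrix_mul continuous_const).matrix_mul
    continuous_const).matrix_mul (Matrix.continuous_exp_neg_smul Aᴴ)

lemma intervalIntegrable_gramianIntegrand (A : Matrix (Fin n) (Fin n) ℂ)
    (B : Matrix (Fin n) (Fin m) ℂ) (i j : Fin n) (a b : ℝ) :
    IntervalIntegrable (fun t => gramianIntegrand A B t i j) volume a b :=
  ((continuous_gramianIntegrand A B).matrix_elem i j).intervalIntegrable a b

/-- Constant matrices can be moved into an entrywise integral. -/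
lemma Matrix.mul_of_intervalIntegral_mul {p q r s : ℕ} {F : ℝ → Matrix (Fin q) (Fin r) ℂ} {a b : ℝ}
    (hF : ∀ i j, IntervalIntegrable (fun t => F t i j) volume a b)
    (X : Matrix (Fin p) (Fin q) ℂ) (Y : Matrix (Fin r) (Fin s) ℂ) :
    X * (Matrix.of fun i j => ∫ t in a..b, F t i j) * Y =
      Matrix.of fun i j => ∫ t in a..b, (X * F t * Y) i j := by
  ext i j
  simp only [Matrix.mul_apply, Matrix.of_apply]
  rw [intervalIntegral.integral_finsetSum]
  · refine Finset.sum_congr rfl fun l _ => ?_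
    rw [intervalIntegral.integral_mul_const, intervalIntegral.integral_finsetSum]
    · simp only [intervalIntegral.integral_const_mul]
    · exact fun k _ => (hF k l).const_mul _
  · intro l _
    refine IntervalIntegrable.mul_const ?_ _
    simpa only [Finset.sum_fn] using
      IntervalIntegrable.sum Finset.univ fun k _ => (hF k l).const_mul (X i k)

lemma mul_gramian_mul {p q : ℕ} (A : Matrix (Fin n) (Fin n) ℂ) (B : Matrix (Fin n) (Fin m) ℂ)
    (T : ℝ) (X : Matrix (Fin p) (Fin n) ℂ) (Y : Matrix (Fin n) (Fin q) ℂ) :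
    X * gramian A B T * Y =
      Matrix.of fun i j => ∫ t in (0 : ℝ)..T, (X * gramianIntegrand A B t * Y) i j :=
  Matrix.mul_of_intervalIntegral_mul
    (fun i j => intervalIntegrable_gramianIntegrand A B i j 0 T) X Y

lemma star_dotProduct_gramian_mulVec (A : Matrix (Fin n) (Fin n) ℂ) (B : Matrix (Fin n) (Fin m) ℂ)
    (T : ℝ) (x : Fin n → ℂ) :
    star x ⬝ᵥ gramian A B T *ᵥ x =
      ∫ t in (0 : ℝ)..T, star x ⬝ᵥ gramianIntegrand A B t *ᵥ x := by
  -- The quadratic form is a product with a one-row and a one-column matrix.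
  have h := congrFun (congrFun (mul_gramian_mul A B T (Matrix.of fun (_ : Fin 1) i => star x i)
    (Matrix.of fun i (_ : Fin 1) => x i)) 0) 0
  simp only [Matrix.mul_assoc] at h
  exact h

/-- The quadratic form of the integrand is the squared norm of `x† e^{-At} B`. -/
lemma star_dotProduct_gramianIntegrand_mulVec (A : Matrix (Fin n) (Fin n) ℂ)
    (B : Matrix (Fin n) (Fin m) ℂ) (t : ℝ) (x : Fin n → ℂ) :
    star x ⬝ᵥ gramianIntegrand A B t *ᵥ x =
      ((∑ j, ‖(star x ᵥ* (NormedSpace.exp (-(t • A)) * B)) j‖ ^ 2 : ℝ) : ℂ) := by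
  rw [gramianIntegrand_eq, ← Matrix.mulVec_mulVec, Matrix.dotProduct_mulVec]
  set C := NormedSpace.exp (-(t • A)) * B
  have : Cᴴ *ᵥ x = star (star x ᵥ* C) := by rw [Matrix.star_vecMul, star_star]
  rw [this, dotProduct]
  push_cast
  refine Finset.sum_congr rfl fun j _ => ?_
  rw [Pi.star_apply, ← Complex.mul_conj']
  rfl

lemma gramian_isHermitian (A : Matrix (Fin n) (Fin n) ℂ) (B : Matrix (Fin n) (Fin m) ℂ)
    (T : ℝ) : (gramian A B T).IsHermitian := by
  ext i j
  simp only [gramian, Matrix.conjTranspose_apply, Matrix.of_apply, RCLike.star_def]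
  refine (Complex.conjCLE.toContinuousLinearMap.intervalIntegral_comp_comm
    (intervalIntegrable_gramianIntegrand A B j i 0 T)).symm.trans ?_
  refine intervalIntegral.integral_congr fun t _ => ?_
  have h : (gramianIntegrand A B t)ᴴ = gramianIntegrand A B t := by
    rw [gramianIntegrand_eq, Matrix.conjTranspose_mul, Matrix.conjTranspose_conjTranspose]
  exact congrFun (congrFun h i) j

lemma star_dotProduct_gramian_mulVec_eq (A : Matrix (Fin n) (Fin n) ℂ)
    (B : Matrix (Fin n) (Fin m) ℂ) (T : ℝ) (x : Fin n → ℂ) :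
    star x ⬝ᵥ gramian A B T *ᵥ x = ((∫ t in (0 : ℝ)..T,
      ∑ j, ‖(star x ᵥ* (NormedSpace.exp (-(t • A)) * B)) j‖ ^ 2 : ℝ) : ℂ) := by
  rw [star_dotProduct_gramian_mulVec]
  simp only [star_dotProduct_gramianIntegrand_mulVec]
  exact intervalIntegral.integral_ofReal

lemma continuous_vecMul_exp_neg_mul (A : Matrix (Fin n) (Fin n) ℂ)
    (B : Matrix (Fin n) (Fin m) ℂ) (x : Fin n → ℂ) :
    Continuous fun t : ℝ => ∑ j, ‖(star x ᵥ* (NormedSpace.exp (-(t • A)) * B)) j‖ ^ 2 := by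
  have h : Continuous fun t : ℝ => star x ᵥ* (NormedSpace.exp (-(t • A)) * B) :=
    continuous_const.matrix_vecMul
      ((Matrix.continuous_exp_neg_smul A).matrix_mul continuous_const)
  exact continuous_finsetSum _ fun j _ => ((continuous_apply j).comp h).norm.pow 2

/-- The quadratic form of the Gramian grows with the horizon. -/
lemma gramian_re_mono (A : Matrix (Fin n) (Fin n) ℂ) (B : Matrix (Fin n) (Fin m) ℂ)
    {S T : ℝ} (hST : S ≤ T) (x : Fin n → ℂ) :
    (star x ⬝ᵥ gramian A B S *ᵥ x).re ≤ (star x ⬝ᵥ gramian A B T *ᵥ x).re := by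
  rw [star_dotProduct_gramian_mulVec_eq, star_dotProduct_gramian_mulVec_eq, Complex.ofReal_re,
    Complex.ofReal_re, ← sub_nonneg, intervalIntegral.integral_interval_sub_left
      ((continuous_vecMul_exp_neg_mul A B x).intervalIntegrable _ _)
      ((continuous_vecMul_exp_neg_mul A B x).intervalIntegrable _ _)]
  exact intervalIntegral.integral_nonneg hST fun t _ => Finset.sum_nonneg fun j _ => by positivity

/-- The semigroup property of the Gramian. -/
lemma gramian_add (A : Matrix (Fin n) (Fin n) ℂ) (B : Matrix (Fin n) (Fin m) ℂ) (T τ : ℝ) :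
    gramian A B (T + τ) = gramian A B τ +
      NormedSpace.exp (-(τ • A)) * gramian A B T * (NormedSpace.exp (-(τ • A)))ᴴ := by
  have key : ∀ t : ℝ, NormedSpace.exp (-(τ • A)) * gramianIntegrand A B t *
      (NormedSpace.exp (-(τ • A)))ᴴ = gramianIntegrand A B (t + τ) := by
    intro t
    have h : NormedSpace.exp (-((t + τ) • A)) =
        NormedSpace.exp (-(τ • A)) * NormedSpace.exp (-(t • A)) := by
      rw [← smul_neg, ← smul_neg, ← smul_neg, add_comm, Matrix.exp_add_smul]
    simp only [gramianIntegrand_eq, h, Matrix.conjTranspose_mul, Matrix.mul_assoc]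
  rw [mul_gramian_mul]
  ext i j
  simp only [gramian, key, Matrix.of_apply, Matrix.add_apply]
  rw [intervalIntegral.integral_comp_add_right (fun t => gramianIntegrand A B t i j), zero_add,
    intervalIntegral.integral_add_adjacent_intervals
      (intervalIntegrable_gramianIntegrand A B i j _ _)
      (intervalIntegrable_gramianIntegrand A B i j _ _)]

/-- The difference quotient of the Gramian at `0` tends to `B B†`. -/
lemma tendsto_slope_gramian (A : Matrix (Fin n) (Fin n) ℂ) (B : Matrix (Fin n) (Fin m) ℂ) :
    Tendsto (fun t : ℝ => t⁻¹ • gramian A B t) (𝓝[≠] 0) (𝓝 (B * Bᴴ)) := by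
  refine tendsto_pi_nhds.2 fun i => tendsto_pi_nhds.2 fun j => ?_
  have hc := (continuous_gramianIntegrand A B).matrix_elem i j
  have h := (intervalIntegral.integral_hasDerivAt_right
    (intervalIntegrable_gramianIntegrand A B i j 0 0)
    (hc.stronglyMeasurableAtFilter _ _) hc.continuousAt).tendsto_slope_zero
  simpa [gramian, gramianIntegrand, NormedSpace.exp_zero] using h

/-- An intertwining map carries the Gramian of `(A, B)` to that of the quotient pair. -/
lemma gramian_of_intertwining {p : ℕ} {R : Matrix (Fin p) (Fin n) ℂ}
    {A : Matrix (Fin n) (Fin n) ℂ} {J : Matrix (Fin p) (Fin p) ℂ} (h : R * A = J * R)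
    (B : Matrix (Fin n) (Fin m) ℂ) (T : ℝ) :
    R * gramian A B T * Rᴴ = gramian J (R * B) T := by
  rw [mul_gramian_mul]
  have hR : ∀ t : ℝ, R * NormedSpace.exp (-(t • A)) = NormedSpace.exp (-(t • J)) * R := by
    intro t
    simpa only [neg_smul] using Matrix.mul_exp_smul_eq h (-t)
  have key : ∀ t : ℝ, R * gramianIntegrand A B t * Rᴴ = gramianIntegrand J (R * B) t := by
    intro t
    have : R * gramianIntegrand A B t * Rᴴ = (R * NormedSpace.exp (-(t • A)) * B) *
        (R * NormedSpace.exp (-(t • A)) * B)ᴴ := by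
      simp only [gramianIntegrand_eq, Matrix.conjTranspose_mul, Matrix.mul_assoc]
    rw [this, hR, gramianIntegrand_eq, Matrix.mul_assoc _ R B]
  simp only [key, gramian]

end Gramian

/-! ### Rank tests and positive definiteness. -/

section Controllability

open scoped ComplexOrder

variable {n m : ℕ}

/-- Kalman's criterion: no nonzero row vector annihilates all `A ^ k * B`. -/
lemma IsControllable.eq_zero {A : Matrix (Fin n) (Fin n) ℂ} {B : Matrix (Fin n) (Fin m) ℂ}
    (h : IsControllable A B) {z : Fin n → ℂ} (hz : ∀ k : ℕ, z ᵥ* (A ^ k * B) = 0) : z = 0 := by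
  have hli : LinearIndependent ℂ (controllabilityMatrix A B).row := by
    rw [linearIndependent_iff_card_eq_finrank_span, Set.finrank, ← Matrix.rank_eq_finrank_span_row]
    simpa using h.symm
  refine Matrix.vecMul_injective_iff.2 hli ?_
  simp only [Matrix.zero_vecMul]
  funext kj
  exact congrFun (hz kj.1) kj.2

/-- The Popov–Belevitch–Hautus test: `B†` vanishes on no eigenvector of `A†`. -/
lemma IsControllable.eq_zero_of_eigenvector {A : Matrix (Fin n) (Fin n) ℂ}
    {B : Matrix (Fin n) (Fin m) ℂ} (h : IsControllable A B) {z : Fin n → ℂ} {c : ℂ}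
    (hA : z ᵥ* A = c • z) (hB : z ᵥ* B = 0) : z = 0 := by
  have hp : ∀ k : ℕ, z ᵥ* A ^ k = c ^ k • z := by
    intro k
    induction k with
    | zero => simp
    | succ k ih => rw [pow_succ, ← Matrix.vecMul_vecMul, ih, Matrix.smul_vecMul, hA, smul_smul,
        pow_succ]
  refine h.eq_zero fun k => ?_
  rw [← Matrix.vecMul_vecMul, hp, Matrix.smul_vecMul, hB, smul_zero]

/-- If the form vanished at `x`, continuity would give `x† e^{-tA} B = 0` on `(0, T)`. Repeated
differentiation yields `x† e^{-tA} A^k B = 0` for all `k`, so Kalman's criterion applies to `x†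
e^{-tA}`, and `e^{-tA}` is invertible. -/
lemma IsControllable.gramian_posDef {A : Matrix (Fin n) (Fin n) ℂ}
    {B : Matrix (Fin n) (Fin m) ℂ} (h : IsControllable A B) {T : ℝ} (hT : 0 < T) :
    (gramian A B T).PosDef := by
  refine Matrix.PosDef.of_dotProduct_mulVec_pos (gramian_isHermitian A B T) fun x hx => ?_
  rw [star_dotProduct_gramian_mulVec_eq]
  refine Complex.zero_lt_real.2 ?_
  have hc := continuous_vecMul_exp_neg_mul A B x
  have hnn : ∀ t : ℝ, 0 ≤ ∑ j, ‖(star x ᵥ* (NormedSpace.exp (-(t • A)) * B)) j‖ ^ 2 :=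
    fun t => Finset.sum_nonneg fun j _ => by positivity
  by_contra hle
  have hzero : ∀ t ∈ Set.Ioo 0 T, star x ᵥ* (NormedSpace.exp (-(t • A)) * B) = 0 := by
    intro t ht
    by_contra hne
    obtain ⟨j, hj⟩ := Function.ne_iff.1 hne
    refine hle (intervalIntegral.integral_pos hT hc.continuousOn (fun s _ => hnn s)
      ⟨t, Set.Ioo_subset_Icc_self ht, ?_⟩)
    exact Finset.sum_pos' (fun j _ => by positivity)
      ⟨j, Finset.mem_univ j, by have := norm_pos_iff.2 hj; positivity⟩
  have hpow : ∀ k : ℕ, ∀ t ∈ Set.Ioo 0 T,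
      star x ᵥ* (NormedSpace.exp (-(t • A)) * (A ^ k * B)) = 0 := by
    intro k
    induction k with
    | zero => simpa using hzero
    | succ k ih =>
      intro t ht
      funext j
      let φ : Matrix (Fin n) (Fin n) ℂ →ₗ[ℝ] ℂ :=
        { toFun := fun M => (star x ᵥ* (M * (A ^ k * B))) j
          map_add' := fun M N => by simp [Matrix.add_mul, Matrix.vecMul_add]
          map_smul' := fun c M => by simp [Matrix.smul_mul, Matrix.vecMul_smul] }
      have hd := Matrix.hasDerivAt_map_exp_smul (-A) φ t
      have hev : (fun s : ℝ => φ (NormedSpace.exp (s • -A))) =ᶠ[𝓝 t] fun _ => 0 := by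
        filter_upwards [Ioo_mem_nhds ht.1 ht.2] with s hs
        have := congrFun (ih s hs) j
        simpa [φ, smul_neg] using this
      have h0 := hd.unique ((hasDerivAt_const t (0 : ℂ)).congr_of_eventuallyEq hev)
      simp only [φ, LinearMap.coe_mk, AddHom.coe_mk, smul_neg, Matrix.mul_neg, Matrix.neg_mul,
        Matrix.vecMul_neg, Pi.neg_apply, neg_eq_zero] at h0
      rw [pow_succ', Matrix.mul_assoc A, ← Matrix.mul_assoc _ A]
      exact h0
  -- Any interior point would do.
  have hmem : T / 2 ∈ Set.Ioo 0 T := ⟨by positivity, by linarith⟩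
  have hz : star x ᵥ* NormedSpace.exp (-((T / 2) • A)) = 0 :=
    h.eq_zero fun k => by rw [Matrix.vecMul_vecMul]; exact hpow k _ hmem
  have hx0 : star x = 0 := by
    rw [← Matrix.vecMul_one (star x), ← Matrix.exp_neg_smul_mul_exp_smul A (T / 2),
      ← Matrix.vecMul_vecMul, hz, Matrix.zero_vecMul]
  exact hx (by simpa using hx0)

end Controllability

/-! ### Loewner order, inversion and monotone convergence. -/

section QuadraticForms

open scoped ComplexOrder

variable {n : ℕ}

lemma Matrix.IsHermitian.star_mulVec {Q : Matrix (Fin n) (Fin n) ℂ} (hQ : Q.IsHermitian)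
    (x : Fin n → ℂ) : star (Q *ᵥ x) = star x ᵥ* Q := by
  rw [Matrix.star_mulVec, hQ.eq]

/-- The quadratic form of a Hermitian matrix takes real values. -/
lemma Matrix.IsHermitian.ofReal_re_star_dotProduct {Q : Matrix (Fin n) (Fin n) ℂ}
    (hQ : Q.IsHermitian) (x : Fin n → ℂ) :
    (((star x ⬝ᵥ Q *ᵥ x).re : ℝ) : ℂ) = star x ⬝ᵥ Q *ᵥ x := by
  refine Complex.conj_eq_iff_re.1 ?_
  rw [← RCLike.star_def, ← Matrix.star_dotProduct_star, star_star, hQ.star_mulVec,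
    ← Matrix.dotProduct_mulVec]

lemma Matrix.PosSemidef.re_star_dotProduct_nonneg {Q : Matrix (Fin n) (Fin n) ℂ}
    (hQ : Q.PosSemidef) (x : Fin n → ℂ) : 0 ≤ (star x ⬝ᵥ Q *ᵥ x).re :=
  (Complex.le_def.1 (hQ.dotProduct_mulVec_nonneg x)).1

/-- Completion of the square for a positive definite matrix and its inverse. -/
lemma Matrix.PosDef.two_re_le {G : Matrix (Fin n) (Fin n) ℂ} (hG : G.PosDef) (v w : Fin n → ℂ) :
    2 * (star v ⬝ᵥ w).re ≤ (star v ⬝ᵥ G⁻¹ *ᵥ v).re + (star w ⬝ᵥ G *ᵥ w).re := by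
  have hdet : IsUnit G.det := (Matrix.isUnit_iff_isUnit_det G).1 hG.isUnit
  -- Expanding the form of `G` at `G⁻¹ v - w` gives the inequality.
  have h := hG.posSemidef.re_star_dotProduct_nonneg (G⁻¹ *ᵥ v - w)
  have h1 : G *ᵥ (G⁻¹ *ᵥ v - w) = v - G *ᵥ w := by
    rw [Matrix.mulVec_sub, Matrix.mulVec_mulVec, Matrix.mul_nonsing_inv _ hdet, Matrix.one_mulVec]
  have h2 : star (G⁻¹ *ᵥ v) ⬝ᵥ (v - G *ᵥ w) = star v ⬝ᵥ G⁻¹ *ᵥ v - star v ⬝ᵥ w := by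
    rw [hG.inv.isHermitian.star_mulVec, ← Matrix.dotProduct_mulVec, Matrix.mulVec_sub,
      Matrix.mulVec_mulVec _ G⁻¹ G, Matrix.nonsing_inv_mul _ hdet, Matrix.one_mulVec,
      dotProduct_sub]
  have h3 : (star w ⬝ᵥ v).re = (star v ⬝ᵥ w).re := by
    rw [← star_star v, Matrix.star_dotProduct_star, star_star, dotProduct_comm]
    simp
  rw [h1, star_sub, sub_dotProduct, h2, dotProduct_sub] at h
  simp only [Complex.sub_re, h3] at h
  linarith

/-- Inversion reverses the order of positive definite matrices. -/
lemma Matrix.PosDef.re_inv_le {G H : Matrix (Fin n) (Fin n) ℂ} (hG : G.PosDef) (hH : H.PosDef)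
    (hle : ∀ x, (star x ⬝ᵥ G *ᵥ x).re ≤ (star x ⬝ᵥ H *ᵥ x).re) (x : Fin n → ℂ) :
    (star x ⬝ᵥ H⁻¹ *ᵥ x).re ≤ (star x ⬝ᵥ G⁻¹ *ᵥ x).re := by
  -- With `w = H⁻¹ x` the cross term is `2 x† H⁻¹ x`, and `w† G w ≤ w† H w = x† H⁻¹ x` absorbs half
  -- of it.
  have h1 := hG.two_re_le x (H⁻¹ *ᵥ x)
  have h2 := hle (H⁻¹ *ᵥ x)
  rw [Matrix.mulVec_mulVec x H,
    Matrix.mul_nonsing_inv _ ((Matrix.isUnit_iff_isUnit_det H).1 hH.isUnit), Matrix.one_mulVec, hH.inv.isHermitian.star_mulVec, ← Matrix.dotProduct_mulVec] at h2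
  rw [hH.inv.isHermitian.star_mulVec, ← Matrix.dotProduct_mulVec] at h1
  rw [← Matrix.dotProduct_mulVec] at h2
  linarith

/-- Turns convergence of quadratic forms into convergence of matrix entries. -/
lemma Matrix.polarization (Q : Matrix (Fin n) (Fin n) ℂ) (x y : Fin n → ℂ) :
    star x ⬝ᵥ Q *ᵥ y = 4⁻¹ * (star (x + y) ⬝ᵥ Q *ᵥ (x + y) - star (x - y) ⬝ᵥ Q *ᵥ (x - y)
      - Complex.I * (star (x + Complex.I • y) ⬝ᵥ Q *ᵥ (x + Complex.I • y)
        - star (x - Complex.I • y) ⬝ᵥ Q *ᵥ (x - Complex.I • y))) := by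
  simp only [star_add, star_sub, star_smul, Matrix.mulVec_add, Matrix.mulVec_sub,
    Matrix.mulVec_smul, add_dotProduct, sub_dotProduct, dotProduct_add, dotProduct_sub,
    smul_dotProduct, dotProduct_smul, smul_eq_mul, RCLike.star_def, Complex.conj_I]
  ring_nf
  rw [Complex.I_sq]
  ring

/-- A family of positive semidefinite matrices that eventually decreases converges. -/
lemma Matrix.exists_tendsto_of_antitone {Q : ℝ → Matrix (Fin n) (Fin n) ℂ}
    (hQ : ∀ T, 0 < T → (Q T).PosSemidef)
    (hanti : ∀ S T, 0 < S → S ≤ T → ∀ x, (star x ⬝ᵥ Q T *ᵥ x).re ≤ (star x ⬝ᵥ Q S *ᵥ x).re) :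
    ∃ L : Matrix (Fin n) (Fin n) ℂ, Tendsto Q atTop (𝓝 L) := by
  have hq : ∀ x : Fin n → ℂ, ∃ l : ℂ, Tendsto (fun T => star x ⬝ᵥ Q T *ᵥ x) atTop (𝓝 l) := by
    intro x
    -- Monotonicity is assumed for positive horizons only; replacing `T` by `max T 1` extends it to
    -- all of `ℝ` without changing the limit.
    have hmax : ∀ T : ℝ, 0 < max T 1 := fun T => lt_max_of_lt_right one_pos
    have ha : Antitone fun T : ℝ => (star x ⬝ᵥ Q (max T 1) *ᵥ x).re :=
      fun S T hST => hanti _ _ (hmax S) (max_le_max_right 1 hST) x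
    have hb : BddBelow (Set.range fun T : ℝ => (star x ⬝ᵥ Q (max T 1) *ᵥ x).re) :=
      ⟨0, by rintro _ ⟨T, rfl⟩; exact (hQ _ (hmax T)).re_star_dotProduct_nonneg x⟩
    have ht := (Complex.continuous_ofReal.tendsto _).comp (tendsto_atTop_ciInf ha hb)
    refine ⟨_, ht.congr' ?_⟩
    filter_upwards [eventually_ge_atTop 1] with T hT
    rw [Function.comp_apply, (hQ _ (hmax T)).isHermitian.ofReal_re_star_dotProduct, max_eq_left hT]
  choose l hl using hq
  have hpol : ∀ x y : Fin n → ℂ, ∃ c : ℂ, Tendsto (fun T => star x ⬝ᵥ Q T *ᵥ y) atTop (𝓝 c) := by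
    intro x y
    have := (((hl (x + y)).sub (hl (x - y))).sub
      (((hl (x + Complex.I • y)).sub (hl (x - Complex.I • y))).const_mul Complex.I)).const_mul 4⁻¹
    exact ⟨_, this.congr fun T => (Matrix.polarization (Q T) x y).symm⟩
  choose c hc using hpol
  refine ⟨Matrix.of fun i j => c (Pi.single i 1) (Pi.single j 1),
    tendsto_pi_nhds.2 fun i => tendsto_pi_nhds.2 fun j => ?_⟩
  refine (hc (Pi.single i 1) (Pi.single j 1)).congr fun T => ?_
  have : star (Pi.single i 1 : Fin n → ℂ) = Pi.single i 1 := by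
    rw [← Pi.single_star, star_one]
  rw [this, single_one_dotProduct, Matrix.mulVec_single_one]
  rfl

lemma Matrix.tendsto_star_dotProduct {Q : ℝ → Matrix (Fin n) (Fin n) ℂ}
    {L : Matrix (Fin n) (Fin n) ℂ} (h : Tendsto Q atTop (𝓝 L)) (x : Fin n → ℂ) :
    Tendsto (fun T => (star x ⬝ᵥ Q T *ᵥ x).re) atTop (𝓝 (star x ⬝ᵥ L *ᵥ x).re) := by
  have hc : Continuous fun M : Matrix (Fin n) (Fin n) ℂ => (star x ⬝ᵥ M *ᵥ x).re :=
    Complex.continuous_re.comp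
      (Continuous.dotProduct continuous_const (continuous_id.matrix_mulVec continuous_const))
  exact (hc.tendsto L).comp h

lemma Matrix.posSemidef_of_tendsto {Q : ℝ → Matrix (Fin n) (Fin n) ℂ}
    {L : Matrix (Fin n) (Fin n) ℂ} (h : Tendsto Q atTop (𝓝 L))
    (hQ : ∀ T, 0 < T → (Q T).PosSemidef) : L.PosSemidef := by
  have hherm : L.IsHermitian := by
    have h1 : Tendsto (fun T => (Q T)ᴴ) atTop (𝓝 Lᴴ) :=
      ((continuous_id.matrix_conjTranspose).tendsto L).comp h
    refine tendsto_nhds_unique (h1.congr' ?_) h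
    filter_upwards [eventually_gt_atTop 0] with T hT using (hQ T hT).isHermitian
  refine Matrix.PosSemidef.of_dotProduct_mulVec_nonneg hherm fun x => ?_
  rw [← hherm.ofReal_re_star_dotProduct]
  refine Complex.zero_le_real.2 (ge_of_tendsto (Matrix.tendsto_star_dotProduct h x) ?_)
  filter_upwards [eventually_gt_atTop 0] with T hT using (hQ T hT).re_star_dotProduct_nonneg x

end QuadraticForms

/-! ### The limit of the inverse Gramian and its Riccati equation. -/

section InverseGramian

open scoped ComplexOrder

variable {n m : ℕ} {A : Matrix (Fin n) (Fin n) ℂ} {B : Matrix (Fin n) (Fin m) ℂ}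

/-- The inverse Gramian of a controllable pair converges as the horizon grows. -/
lemma IsControllable.exists_tendsto_inv_gramian (h : IsControllable A B) :
    ∃ L : Matrix (Fin n) (Fin n) ℂ, Tendsto (fun T => (gramian A B T)⁻¹) atTop (𝓝 L) :=
  Matrix.exists_tendsto_of_antitone (fun _ hT => (h.gramian_posDef hT).inv.posSemidef)
    fun _ _ hS hST => (h.gramian_posDef hS).re_inv_le (h.gramian_posDef (hS.trans_le hST))
      (gramian_re_mono A B hST)

lemma IsControllable.posSemidef_of_tendsto_inv_gramian (h : IsControllable A B)
    {L : Matrix (Fin n) (Fin n) ℂ} (hL : Tendsto (fun T => (gramian A B T)⁻¹) atTop (𝓝 L)) :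
    L.PosSemidef :=
  Matrix.posSemidef_of_tendsto hL fun _ hT => (h.gramian_posDef hT).inv.posSemidef

/-- The fixed-point equation of the limit of the inverse Gramian. -/
lemma IsControllable.limit_inv_gramian_eq (h : IsControllable A B) {L : Matrix (Fin n) (Fin n) ℂ}
    (hL : Tendsto (fun T => (gramian A B T)⁻¹) atTop (𝓝 L)) (τ : ℝ) :
    L * (gramian A B τ *
      ((NormedSpace.exp (τ • A))ᴴ * L * NormedSpace.exp (τ • A)) + 1) =
      (NormedSpace.exp (τ • A))ᴴ * L * NormedSpace.exp (τ • A) := by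
  set E := NormedSpace.exp (τ • A) with hE
  have hM : Tendsto (fun T => Eᴴ * (gramian A B T)⁻¹ * E) atTop (𝓝 (Eᴴ * L * E)) :=
    (((continuous_const.matrix_mul continuous_id).matrix_mul continuous_const).tendsto L).comp hL
  -- The equation is kept in product form because `L` may be singular.
  have hc : Continuous fun p : Matrix (Fin n) (Fin n) ℂ × Matrix (Fin n) (Fin n) ℂ =>
      p.1 * (gramian A B τ * p.2 + 1) :=
    continuous_fst.matrix_mul ((continuous_const.matrix_mul continuous_snd).add continuous_const)
  have hl := (hc.tendsto (L, Eᴴ * L * E)).comp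
    ((hL.comp (tendsto_atTop_add_const_right atTop τ tendsto_id)).prodMk_nhds hM)
  refine tendsto_nhds_unique (hl.congr' ?_) hM
  filter_upwards [eventually_gt_atTop 0, eventually_gt_atTop (-τ)] with T hT hTτ
  have hpos : 0 < T + τ := by linarith
  have hdet := (Matrix.isUnit_iff_isUnit_det _).1 (h.gramian_posDef hT).isUnit
  have hdet' := (Matrix.isUnit_iff_isUnit_det _).1 (h.gramian_posDef hpos).isUnit
  have hFE : (NormedSpace.exp (-(τ • A)))ᴴ * Eᴴ = 1 := by
    rw [← Matrix.conjTranspose_mul, hE, Matrix.exp_smul_mul_exp_neg_smul,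
      Matrix.conjTranspose_one]
  have key : gramian A B (T + τ) * (Eᴴ * (gramian A B T)⁻¹ * E) =
      gramian A B τ * (Eᴴ * (gramian A B T)⁻¹ * E) + 1 := by
    rw [gramian_add, Matrix.add_mul]
    congr 1
    calc NormedSpace.exp (-(τ • A)) * gramian A B T * (NormedSpace.exp (-(τ • A)))ᴴ *
          (Eᴴ * (gramian A B T)⁻¹ * E)
        = NormedSpace.exp (-(τ • A)) * gramian A B T *
          ((NormedSpace.exp (-(τ • A)))ᴴ * Eᴴ) * (gramian A B T)⁻¹ * E := by
          simp only [Matrix.mul_assoc]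
      _ = 1 := by
          rw [hFE, Matrix.mul_one, Matrix.mul_assoc _ (gramian A B T),
            Matrix.mul_nonsing_inv _ hdet, Matrix.mul_one, hE, Matrix.exp_neg_smul_mul_exp_smul]
  simp only [Function.comp_apply, id_eq]
  rw [← key, ← Matrix.mul_assoc, Matrix.nonsing_inv_mul _ hdet', Matrix.one_mul]

/-- The limit of the inverse Gramian solves the algebraic Riccati equation. -/
lemma IsControllable.riccati (h : IsControllable A B) {L : Matrix (Fin n) (Fin n) ℂ}
    (hL : Tendsto (fun T => (gramian A B T)⁻¹) atTop (𝓝 L)) :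
    L * (B * Bᴴ) * L = L * A + Aᴴ * L := by
  have hexp : Tendsto (fun t : ℝ => NormedSpace.exp (t • A)) (𝓝[≠] 0) (𝓝 1) := by
    have := (Matrix.continuous_exp_smul A).tendsto 0
    rw [zero_smul, NormedSpace.exp_zero] at this
    exact this.mono_left nhdsWithin_le_nhds
  have hexpH : Tendsto (fun t : ℝ => (NormedSpace.exp (t • A))ᴴ) (𝓝[≠] 0) (𝓝 1) := by
    have := ((continuous_id.matrix_conjTranspose).tendsto (1 : Matrix (Fin n) (Fin n) ℂ)).comp hexp
    rwa [id_eq, Matrix.conjTranspose_one] at this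
  have hs := Matrix.tendsto_slope_exp_smul A
  have hsH := ((continuous_id.matrix_conjTranspose).tendsto A).comp hs
  have hLc : Tendsto (fun _ : ℝ => L) (𝓝[≠] 0) (𝓝 L) := tendsto_const_nhds
  -- The fixed-point equation is divided by `t`, with `E† L E - L` split as `E† L (E - 1) + (E† - 1)
  -- L`.
  have hleft := ((hLc.mul (tendsto_slope_gramian A B)).mul ((hexpH.mul hLc).mul hexp))
  have hright := ((hexpH.mul hLc).mul hs).add (hsH.mul hLc)
  simp only [Matrix.one_mul, Matrix.mul_one, id_eq] at hleft hright
  refine tendsto_nhds_unique (hleft.congr fun t => ?_) hright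
  have heq := h.limit_inv_gramian_eq hL t
  set E := NormedSpace.exp (t • A)
  have h1 : L * gramian A B t * (Eᴴ * L * E) = Eᴴ * L * E - L := by
    rwa [Matrix.mul_add, Matrix.mul_one, ← Matrix.mul_assoc, ← eq_sub_iff_add_eq] at heq
  simp only [Function.comp_apply, Matrix.conjTranspose_smul, Matrix.conjTranspose_sub,
    Matrix.conjTranspose_one, star_trivial, Matrix.mul_smul, Matrix.smul_mul, h1, ← smul_add]
  congr 1
  noncomm_ring

/-- A positive semidefinite solution of the Riccati equation vanishes along Jordan chains whose
eigenvalue has non-positive real part. -/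
lemma IsControllable.mulVec_eq_zero_of_riccati (h : IsControllable A B)
    {L : Matrix (Fin n) (Fin n) ℂ} (hL : L.PosSemidef) (hR : L * (B * Bᴴ) * L = L * A + Aᴴ * L)
    {v w : Fin n → ℂ} {c : ℂ} (hc : c.re ≤ 0) (hv : A *ᵥ v = c • v + w) (hw : L *ᵥ w = 0) :
    L *ᵥ v = 0 := by
  set z := L *ᵥ v with hz
  have hherm := hL.isHermitian
  have hvec : L *ᵥ (B *ᵥ (Bᴴ *ᵥ z)) = c • z + Aᴴ *ᵥ z := by
    have := congrArg (fun M => M *ᵥ v) hR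
    simp only [Matrix.add_mulVec, ← Matrix.mulVec_mulVec, hv, Matrix.mulVec_add,
      Matrix.mulVec_smul, hw, add_zero] at this
    exact this
  have hBz : star z ᵥ* B = star (Bᴴ *ᵥ z) := by
    rw [Matrix.star_mulVec Bᴴ z, Matrix.conjTranspose_conjTranspose]
  have hAz : star z ᵥ* A = star (Aᴴ *ᵥ z) := by
    rw [Matrix.star_mulVec Aᴴ z, Matrix.conjTranspose_conjTranspose]
  have hq := hL.re_star_dotProduct_nonneg v
  have hqr := hherm.ofReal_re_star_dotProduct v
  rw [← hz] at hq hqr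
  set q := (star v ⬝ᵥ z).re
  -- Pairing `hvec` with `v` gives `‖B† z‖² = 2 Re(c) q`, where `q ≥ 0`.
  have hB0 : Bᴴ *ᵥ z = 0 := by
    have e1 : star v ⬝ᵥ L *ᵥ (B *ᵥ (Bᴴ *ᵥ z)) = star (Bᴴ *ᵥ z) ⬝ᵥ (Bᴴ *ᵥ z) := by
      rw [Matrix.dotProduct_mulVec, ← hherm.star_mulVec, Matrix.dotProduct_mulVec, ← hBz]
    have e2 : star v ⬝ᵥ Aᴴ *ᵥ z = star c * q := by
      rw [Matrix.dotProduct_mulVec, ← Matrix.star_mulVec, hv, star_add, add_dotProduct, star_smul,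
        smul_dotProduct, ← hqr, hz, Matrix.dotProduct_mulVec (star w), ← hherm.star_mulVec, hw,
        star_zero, zero_dotProduct, add_zero, smul_eq_mul]
    rw [hvec, dotProduct_add, dotProduct_smul, e2, ← hqr, smul_eq_mul] at e1
    have hre := congrArg Complex.re e1
    simp only [Complex.add_re, Complex.mul_re, Complex.ofReal_re, Complex.ofReal_im, mul_zero,
      sub_zero, RCLike.star_def, Complex.conj_re] at hre
    have hnn := dotProduct_star_self_nonneg (star (Bᴴ *ᵥ z))
    rw [star_star, dotProduct_comm] at hnn
    obtain ⟨hn1, hn2⟩ := Complex.le_def.1 hnn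
    simp only [Complex.zero_re, Complex.zero_im] at hn1 hn2
    have hcq : c.re * q ≤ 0 := mul_nonpos_of_nonpos_of_nonneg hc hq
    refine dotProduct_star_self_eq_zero.1 ?_
    rw [dotProduct_comm] at hn1 hn2 hre
    rw [dotProduct_comm]
    exact Complex.ext (by rw [Complex.zero_re]; linarith) hn2.symm
  rw [hB0, Matrix.mulVec_zero, Matrix.mulVec_zero] at hvec
  have hA0 : Aᴴ *ᵥ z = (-c) • z := by
    rw [neg_smul]
    exact (neg_eq_of_add_eq_zero_right hvec.symm).symm
  have : star z = 0 := h.eq_zero_of_eigenvector (c := star (-c))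
    (by rw [hAz, hA0, star_smul]) (by rw [hBz, hB0, star_zero])
  simpa using this

end InverseGramian

/-! ### Jordan matrices: generalized eigenvectors and exponential decay. -/

section Jordan

variable {p : ℕ} {J : Matrix (Fin p) (Fin p) ℂ}

/-- The action of a matrix in Jordan normal form on a standard basis vector. -/
lemma IsJordanNormalForm.mulVec_single (hJ : IsJordanNormalForm J) (j : Fin p) :
    J *ᵥ Pi.single j 1 = J j j • (Pi.single j 1 : Fin p → ℂ) ∨
      ∃ i : Fin p, (j : ℕ) = i + 1 ∧ J i i = J j j ∧
        J *ᵥ Pi.single j 1 = J j j • (Pi.single j 1 : Fin p → ℂ) + Pi.single i 1 := by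
  by_cases h : ∃ i : Fin p, (j : ℕ) = i + 1 ∧ J i j ≠ 0
  · obtain ⟨i, hij, hne⟩ := h
    obtain ⟨h1, h2⟩ := (hJ.2 i j hij).resolve_left hne
    refine Or.inr ⟨i, hij, h2, funext fun k => ?_⟩
    have hji : j ≠ i := fun h => by rw [h] at hij; omega
    simp only [Matrix.mulVec_single_one, Matrix.col_apply, Pi.add_apply, Pi.smul_apply,
      smul_eq_mul]
    rcases eq_or_ne k j with rfl | hkj
    · simp [hji]
    · rcases eq_or_ne k i with rfl | hki
      · simp [h1, hkj]
      · rw [hJ.1 k j hkj.symm fun h => hki (Fin.ext (by omega))]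
        simp [hkj, hki]
  · push Not at h
    refine Or.inl (funext fun k => ?_)
    simp only [Matrix.mulVec_single_one, Matrix.col_apply, Pi.smul_apply, smul_eq_mul]
    rcases eq_or_ne k j with rfl | hkj
    · simp
    · by_cases hk : (j : ℕ) = k + 1
      · simp [h k hk, hkj]
      · simp [hJ.1 k j hkj.symm hk, hkj]

/-- Transfers spectral hypotheses to diagonal entries: `J` is upper triangular, so the determinant
of `J i i - J` has a zero factor. -/
lemma IsJordanNormalForm.diag_mem_spectrum (hJ : IsJordanNormalForm J) (i : Fin p) :
    J i i ∈ spectrum ℂ J := by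
  rw [spectrum.mem_iff, Matrix.isUnit_iff_isUnit_det, Matrix.det_of_isUpperTriangular]
  · rw [isUnit_iff_ne_zero, not_not]
    exact Finset.prod_eq_zero (Finset.mem_univ i) (by simp [Matrix.algebraMap_matrix_apply])
  · intro k l hlk
    have hlk' : l < k := hlk
    rw [Matrix.sub_apply, Matrix.algebraMap_matrix_apply, if_neg hlk'.ne',
      hJ.1 k l hlk'.ne (fun h => by have := Fin.lt_def.1 hlk'; omega), sub_zero]

/-- Each standard basis vector is a generalized eigenvector. -/
lemma IsJordanNormalForm.pow_mulVec_single (hJ : IsJordanNormalForm J) (j : Fin p) :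
    ∃ N : ℕ, (J - J j j • 1) ^ N *ᵥ (Pi.single j 1 : Fin p → ℂ) = 0 := by
  obtain ⟨j, hj⟩ := j
  induction j with
  | zero =>
    refine ⟨1, ?_⟩
    rcases hJ.mulVec_single ⟨0, hj⟩ with h | ⟨i, hi, -⟩
    · rw [pow_one, Matrix.sub_mulVec, h, Matrix.smul_mulVec, Matrix.one_mulVec, sub_self]
    · simp at hi
  | succ j ih =>
    rcases hJ.mulVec_single ⟨j + 1, hj⟩ with h | ⟨i, hi, hd, h⟩
    · refine ⟨1, ?_⟩
      rw [pow_one, Matrix.sub_mulVec, h, Matrix.smul_mulVec, Matrix.one_mulVec, sub_self]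
    · obtain ⟨N, hN⟩ := ih (by omega)
      have hij : i = ⟨j, by omega⟩ := Fin.ext (by simpa using hi.symm)
      rw [← hij, hd] at hN
      refine ⟨N + 1, ?_⟩
      rw [pow_succ, ← Matrix.mulVec_mulVec, Matrix.sub_mulVec, h, Matrix.smul_mulVec,
        Matrix.one_mulVec, add_sub_cancel_left, hN]

/-- Splits off the commuting scalar part; the remaining series terminates on generalized
eigenvectors for `c`. -/
lemma Matrix.exp_smul_eq_smul_exp_sub (J : Matrix (Fin p) (Fin p) ℂ) (c : ℂ) (t : ℝ) :
    NormedSpace.exp (t • J) = Complex.exp (t * c) • NormedSpace.exp (t • (J - c • 1)) := by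
  have h1 : t • J = (t * c : ℂ) • (1 : Matrix (Fin p) (Fin p) ℂ) + t • (J - c • 1) := by
    rw [smul_sub, ← add_sub_assoc, mul_smul, Complex.coe_smul, add_sub_cancel_left]
  have h2 : NormedSpace.exp ((t * c : ℂ) • (1 : Matrix (Fin p) (Fin p) ℂ)) =
      Complex.exp (t * c) • (1 : Matrix (Fin p) (Fin p) ℂ) := by
    rw [Matrix.smul_one_eq_diagonal, Matrix.exp_diagonal, Matrix.smul_one_eq_diagonal]
    congr 1
    funext i
    rw [Pi.coe_exp, Complex.exp_eq_exp_ℂ]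
  rw [h1, Matrix.exp_add_of_commute _ _ ((Commute.one_left _).smul_left _), h2,
    Matrix.smul_mul, Matrix.one_mul]

/-- The exponential acts on a generalized eigenvector by an exponential polynomial. -/
lemma Matrix.exp_smul_mulVec_of_pow_mulVec_eq_zero {J : Matrix (Fin p) (Fin p) ℂ} {c : ℂ}
    {x : Fin p → ℂ} {N : ℕ} (hN : (J - c • 1) ^ N *ᵥ x = 0) (t : ℝ) (i : Fin p) :
    (NormedSpace.exp (t • J) *ᵥ x) i = Complex.exp (t * c) *
      ∑ k ∈ Finset.range N, ((k.factorial : ℝ)⁻¹ * t ^ k) • ((J - c • 1) ^ k *ᵥ x) i := by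
  rw [Matrix.exp_smul_eq_smul_exp_sub J c t, Matrix.smul_mulVec, Pi.smul_apply, smul_eq_mul]
  congr 1
  have h := (Matrix.hasSum_exp_smul (J - c • 1) t).map
    (⟨⟨fun M => (M *ᵥ x) i, by simp⟩, fun M M' => by simp [Matrix.add_mulVec]⟩ :
      Matrix (Fin p) (Fin p) ℂ →+ ℂ)
    ((continuous_apply i).comp (continuous_id.matrix_mulVec continuous_const))
  refine h.unique ?_
  have hs := hasSum_sum_of_ne_finset_zero (L := .unconditional ℕ) (s := Finset.range N)
    (f := fun k : ℕ => ((k.factorial : ℝ)⁻¹ * t ^ k) • ((J - c • 1) ^ k *ᵥ x) i) fun k hk => by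
      have hk' : N ≤ k := by simpa using hk
      rw [← Nat.sub_add_cancel hk', pow_add (J - c • 1), ← Matrix.mulVec_mulVec, hN]
      simp
  have hfun : ∀ k : ℕ, ((((k.factorial : ℝ)⁻¹ * t ^ k) • (J - c • 1) ^ k) *ᵥ x) i =
      ((k.factorial : ℝ)⁻¹ * t ^ k) • ((J - c • 1) ^ k *ᵥ x) i := fun k => by
    rw [Matrix.smul_mulVec, Pi.smul_apply]
  exact hs.congr_fun hfun

/-- `e^{-tJ}` decays exponentially if the diagonal of `J` lies in a right half plane. -/
lemma IsJordanNormalForm.exp_neg_isBigO (hJ : IsJordanNormalForm J) {ε : ℝ}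
    (hε : ∀ j, ε < (J j j).re) (i j : Fin p) :
    (fun t : ℝ => NormedSpace.exp (-(t • J)) i j) =O[atTop] fun t => Real.exp (-ε * t) := by
  obtain ⟨N, hN⟩ := hJ.pow_mulVec_single j
  have h : ∀ t : ℝ, NormedSpace.exp (-(t • J)) i j =
      ∑ k ∈ Finset.range N, Complex.exp ((-t : ℝ) * J j j) *
        (((k.factorial : ℝ)⁻¹ * (-t) ^ k) • ((J - J j j • 1) ^ k *ᵥ Pi.single j 1) i) := by
    intro t
    rw [← Finset.mul_sum, ← Matrix.exp_smul_mulVec_of_pow_mulVec_eq_zero hN, neg_smul]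
    simp
  simp only [h]
  refine Asymptotics.IsBigO.fun_sum fun k _ => ?_
  set a := ((J - J j j • 1) ^ k *ᵥ Pi.single j 1) i
  -- The gap between `(J j j).re` and `ε` absorbs the polynomial factor.
  have hpow := (isLittleO_pow_exp_pos_mul_atTop k (sub_pos.2 (hε j))).isBigO
  have hmul := ((Asymptotics.isBigO_refl (fun t : ℝ => Real.exp (-(J j j).re * t)) atTop).mul
    hpow).const_mul_left ((k.factorial : ℝ)⁻¹ * ‖a‖)
  have hexp : ∀ t : ℝ, Real.exp (-(J j j).re * t) * Real.exp (((J j j).re - ε) * t) =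
      Real.exp (-ε * t) := fun t => by rw [← Real.exp_add]; congr 1; ring
  simp only [hexp] at hmul
  refine Asymptotics.IsBigO.trans (Asymptotics.IsBigO.of_norm_eventuallyLE ?_) hmul
  filter_upwards [eventually_ge_atTop 0] with t ht
  rw [norm_mul, norm_smul, Complex.norm_exp, norm_mul, norm_pow, norm_neg, norm_inv,
    Complex.re_ofReal_mul, Real.norm_of_nonneg ht, Real.norm_of_nonneg (Nat.cast_nonneg _)]
  apply le_of_eq
  ring_nf

variable {m : ℕ}

/-- Finitely many conditions hold for all small `ε`; no minimum is taken, so `p = 0` is covered. -/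
lemma IsJordanNormalForm.exists_pos_lt_re (h : ∀ j, 0 < (J j j).re) :
    ∃ ε : ℝ, 0 < ε ∧ ∀ j, ε < (J j j).re := by
  have h1 : ∀ᶠ ε : ℝ in 𝓝[>] 0, ∀ j, ε < (J j j).re :=
    eventually_all.2 fun j => nhdsWithin_le_nhds (eventually_lt_nhds (h j))
  obtain ⟨ε, hε, h0⟩ := (h1.and self_mem_nhdsWithin).exists
  exact ⟨ε, h0, hε⟩

lemma IsJordanNormalForm.tendsto_exp_neg (hJ : IsJordanNormalForm J)
    (h : ∀ j, 0 < (J j j).re) :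
    Tendsto (fun t : ℝ => NormedSpace.exp (-(t • J))) atTop (𝓝 0) := by
  obtain ⟨ε, h0, hε⟩ := IsJordanNormalForm.exists_pos_lt_re h
  refine tendsto_pi_nhds.2 fun i => tendsto_pi_nhds.2 fun j => ?_
  refine (hJ.exp_neg_isBigO hε i j).trans_tendsto ?_
  refine Real.tendsto_exp_atBot.comp ?_
  exact tendsto_id.const_mul_atTop_of_neg (neg_neg_of_pos h0)

/-- The infinite-horizon Gramian of an antistable Jordan matrix converges absolutely. -/
lemma IsJordanNormalForm.integrableOn_gramianIntegrand (hJ : IsJordanNormalForm J)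
    (h : ∀ j, 0 < (J j j).re) (C : Matrix (Fin p) (Fin m) ℂ) (i j : Fin p) :
    IntegrableOn (fun t : ℝ => gramianIntegrand J C t i j) (Set.Ioi 0) := by
  obtain ⟨ε, h0, hε⟩ := IsJordanNormalForm.exists_pos_lt_re h
  have hC : ∀ k l, (fun t : ℝ => (NormedSpace.exp (-(t • J)) * C) k l) =O[atTop]
      fun t => Real.exp (-ε * t) := fun k l => by
    simp only [Matrix.mul_apply]
    refine Asymptotics.IsBigO.fun_sum fun r _ => ?_
    simpa only [mul_comm _ (C r l)] using (hJ.exp_neg_isBigO hε k r).const_mul_left (C r l)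
  have hO : (fun t : ℝ => gramianIntegrand J C t i j) =O[atTop]
      fun t => Real.exp (-(ε + ε) * t) := by
    have hexp : ∀ t : ℝ, Real.exp (-(ε + ε) * t) = Real.exp (-ε * t) * Real.exp (-ε * t) :=
      fun t => by rw [← Real.exp_add]; congr 1; ring
    have hsum : ∀ t : ℝ, gramianIntegrand J C t i j =
        ∑ r, (NormedSpace.exp (-(t • J)) * C) i r * star ((NormedSpace.exp (-(t • J)) * C) j r) :=
      fun t => by rw [gramianIntegrand_eq, Matrix.mul_apply]; rfl
    simp only [hsum, hexp]
    refine Asymptotics.IsBigO.fun_sum fun r _ => (hC i r).mul ?_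
    refine Asymptotics.IsBigO.of_norm_left ?_
    simp only [norm_star]
    exact (hC j r).norm_left
  have hcont : Continuous fun t : ℝ => gramianIntegrand J C t i j :=
    (continuous_gramianIntegrand J C).matrix_elem i j
  exact (integrableOn_Ici_iff_integrableOn_Ioi (by finiteness)).mp
    ((hcont.continuousOn.locallyIntegrableOn measurableSet_Ici).integrableOn_of_isBigO_atTop hO
      ⟨Set.Ioi 0, Ioi_mem_atTop 0, exp_neg_integrableOn_Ioi 0 (by positivity)⟩)

lemma IsJordanNormalForm.tendsto_gramian (hJ : IsJordanNormalForm J)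
    (h : ∀ j, 0 < (J j j).re) (C : Matrix (Fin p) (Fin m) ℂ) :
    Tendsto (gramian J C) atTop (𝓝 (gramianInfty J C)) :=
  tendsto_pi_nhds.2 fun i => tendsto_pi_nhds.2 fun j =>
    intervalIntegral_tendsto_integral_Ioi 0 (hJ.integrableOn_gramianIntegrand h C i j) tendsto_id

end Jordan

/-! ### Block decomposition of rows and columns. -/

section Splitting

variable {n nu ns m : ℕ} (h : nu + ns = n)

lemma splitEquiv_inl (i : Fin nu) : (splitEquiv h (Sum.inl i) : ℕ) = i := by
  simp [splitEquiv]

lemma splitEquiv_inr (i : Fin ns) : (splitEquiv h (Sum.inr i) : ℕ) = nu + i := by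
  simp [splitEquiv]

/-- The last `ns` rows of a matrix with `n = nu + ns` rows. -/
def bottomRows (C : Matrix (Fin n) (Fin m) ℂ) : Matrix (Fin ns) (Fin m) ℂ :=
  C.submatrix (fun i => splitEquiv h (Sum.inr i)) id

/-- The first `nu` columns of a matrix with `n = nu + ns` columns. -/
def leftCols (C : Matrix (Fin m) (Fin n) ℂ) : Matrix (Fin m) (Fin nu) ℂ :=
  C.submatrix id fun i => splitEquiv h (Sum.inl i)

/-- The last `ns` columns of a matrix with `n = nu + ns` columns. -/
def rightCols (C : Matrix (Fin m) (Fin n) ℂ) : Matrix (Fin m) (Fin ns) ℂ :=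
  C.submatrix id fun i => splitEquiv h (Sum.inr i)

variable (X : Matrix (Fin nu) (Fin nu) ℂ) (Y : Matrix (Fin ns) (Fin ns) ℂ)

lemma blockDiag₂_inl_inl (i j : Fin nu) :
    blockDiag₂ h X Y (splitEquiv h (Sum.inl i)) (splitEquiv h (Sum.inl j)) = X i j := by
  simp [blockDiag₂]

lemma blockDiag₂_inl_inr (i : Fin nu) (j : Fin ns) :
    blockDiag₂ h X Y (splitEquiv h (Sum.inl i)) (splitEquiv h (Sum.inr j)) = 0 := by
  simp [blockDiag₂]

lemma blockDiag₂_inr_inl (i : Fin ns) (j : Fin nu) :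
    blockDiag₂ h X Y (splitEquiv h (Sum.inr i)) (splitEquiv h (Sum.inl j)) = 0 := by
  simp [blockDiag₂]

lemma blockDiag₂_inr_inr (i j : Fin ns) :
    blockDiag₂ h X Y (splitEquiv h (Sum.inr i)) (splitEquiv h (Sum.inr j)) = Y i j := by
  simp [blockDiag₂]

lemma sum_splitEquiv (f : Fin n → ℂ) : ∑ k, f k =
    ∑ i, f (splitEquiv h (Sum.inl i)) + ∑ i, f (splitEquiv h (Sum.inr i)) := by
  rw [← Equiv.sum_comp (splitEquiv h) f, Fintype.sum_sum_type]

/-- Applied to `P * P⁻¹`, it splits the identity into the two spectral projections. -/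
lemma mul_eq_leftCols_mul_topRows_add {q r : ℕ} (C : Matrix (Fin q) (Fin n) ℂ)
    (D : Matrix (Fin n) (Fin r) ℂ) :
    C * D = leftCols h C * topRows h D + rightCols h C * bottomRows h D := by
  ext i j
  simp only [Matrix.add_apply, Matrix.mul_apply]
  exact sum_splitEquiv h fun k => C i k * D k j

lemma topRows_blockDiag₂_mul (D : Matrix (Fin n) (Fin m) ℂ) :
    topRows h (blockDiag₂ h X Y * D) = X * topRows h D := by
  ext i j
  simp [topRows, Matrix.mul_apply, sum_splitEquiv h, blockDiag₂_inl_inl, blockDiag₂_inl_inr]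

lemma bottomRows_blockDiag₂_mul (D : Matrix (Fin n) (Fin m) ℂ) :
    bottomRows h (blockDiag₂ h X Y * D) = Y * bottomRows h D := by
  ext i j
  simp [bottomRows, Matrix.mul_apply, sum_splitEquiv h, blockDiag₂_inr_inl, blockDiag₂_inr_inr]

lemma rightCols_mul_blockDiag₂ (C : Matrix (Fin m) (Fin n) ℂ) :
    rightCols h (C * blockDiag₂ h X Y) = rightCols h C * Y := by
  ext i j
  simp [rightCols, Matrix.mul_apply, sum_splitEquiv h, blockDiag₂_inl_inr, blockDiag₂_inr_inr]

lemma topRows_mul {q : ℕ} (C : Matrix (Fin n) (Fin q) ℂ) (D : Matrix (Fin q) (Fin m) ℂ) :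
    topRows h (C * D) = topRows h C * D := rfl

variable {h X Y}

lemma IsJordanNormalForm.of_blockDiag₂_left (hJ : IsJordanNormalForm (blockDiag₂ h X Y)) :
    IsJordanNormalForm X := by
  refine ⟨fun i j hne h1 => ?_, fun i j h1 => ?_⟩
  · rw [← blockDiag₂_inl_inl h X Y]
    exact hJ.1 _ _ (fun he => hne (by simpa using he)) (by simpa [splitEquiv_inl] using h1)
  · simpa only [blockDiag₂_inl_inl] using hJ.2 (splitEquiv h (Sum.inl i))
      (splitEquiv h (Sum.inl j)) (by simpa [splitEquiv_inl] using h1)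

lemma IsJordanNormalForm.of_blockDiag₂_right (hJ : IsJordanNormalForm (blockDiag₂ h X Y)) :
    IsJordanNormalForm Y := by
  refine ⟨fun i j hne h1 => ?_, fun i j h1 => ?_⟩
  · rw [← blockDiag₂_inr_inr h X Y]
    refine hJ.1 _ _ (fun he => hne (by simpa using he)) ?_
    rw [splitEquiv_inr, splitEquiv_inr]
    omega
  · simpa only [blockDiag₂_inr_inr] using hJ.2 (splitEquiv h (Sum.inr i))
      (splitEquiv h (Sum.inr j)) (by rw [splitEquiv_inr, splitEquiv_inr]; omega)

end Splitting

/-! ### Kernel and compression of the limit. -/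

section Limit

open scoped ComplexOrder

variable {n m p : ℕ} {A : Matrix (Fin n) (Fin n) ℂ} {B : Matrix (Fin n) (Fin m) ℂ}

lemma IsControllable.isUnit_gramian (hAB : IsControllable A B) {T : ℝ} (hT : 0 < T) :
    IsUnit (gramian A B T) :=
  (hAB.gramian_posDef hT).isUnit

lemma IsControllable.isHermitian_of_tendsto_inv_gramian (hAB : IsControllable A B)
    {L : Matrix (Fin n) (Fin n) ℂ} (hL : Tendsto (fun T => (gramian A B T)⁻¹) atTop (𝓝 L)) :
    L.IsHermitian :=
  (hAB.posSemidef_of_tendsto_inv_gramian hL).isHermitian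

/-- The limit of the inverse Gramian vanishes on invariant subspaces without unstable spectrum. -/
lemma IsControllable.limit_mul_eq_zero (hAB : IsControllable A B) {L : Matrix (Fin n) (Fin n) ℂ}
    (hL : Tendsto (fun T => (gramian A B T)⁻¹) atTop (𝓝 L)) {U : Matrix (Fin n) (Fin p) ℂ}
    {J : Matrix (Fin p) (Fin p) ℂ} (hU : A * U = U * J) (hJ : IsJordanNormalForm J)
    (hre : ∀ j, (J j j).re ≤ 0) : L * U = 0 := by
  -- The columns of `U` form Jordan chains of `A`, so induction on the column index supplies `L w =
  -- 0` for the predecessor `w`; `w = 0` where a chain starts.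
  have hcol : ∀ j : Fin p, L *ᵥ (U *ᵥ Pi.single j 1) = 0 := by
    rintro ⟨j, hj⟩
    induction j with
    | zero =>
      refine hAB.mulVec_eq_zero_of_riccati (hAB.posSemidef_of_tendsto_inv_gramian hL)
        (hAB.riccati hL) (hre ⟨0, hj⟩) (w := 0) ?_ (Matrix.mulVec_zero L)
      rw [Matrix.mulVec_mulVec, hU, ← Matrix.mulVec_mulVec]
      rcases hJ.mulVec_single ⟨0, hj⟩ with h | ⟨i, hi, -⟩
      · rw [h, Matrix.mulVec_smul, add_zero]
      · simp at hi
    | succ j ih =>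
      rcases hJ.mulVec_single ⟨j + 1, hj⟩ with h | ⟨i, hi, -, h⟩
      · refine hAB.mulVec_eq_zero_of_riccati (hAB.posSemidef_of_tendsto_inv_gramian hL)
          (hAB.riccati hL) (hre ⟨j + 1, hj⟩) (w := 0) ?_ (Matrix.mulVec_zero L)
        rw [Matrix.mulVec_mulVec, hU, ← Matrix.mulVec_mulVec, h, Matrix.mulVec_smul, add_zero]
      · have hij : i = ⟨j, by omega⟩ := Fin.ext (by simpa using hi.symm)
        refine hAB.mulVec_eq_zero_of_riccati (hAB.posSemidef_of_tendsto_inv_gramian hL)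
          (hAB.riccati hL) (hre ⟨j + 1, hj⟩) (w := U *ᵥ Pi.single i 1) ?_ (by rw [hij]; exact ih _)
        rw [Matrix.mulVec_mulVec, hU, ← Matrix.mulVec_mulVec, h, Matrix.mulVec_add,
          Matrix.mulVec_smul]
  ext i j
  have := congrFun (hcol j) i
  rw [Matrix.mulVec_mulVec, Matrix.mulVec_single_one] at this
  exact this

/-- If the limit of the inverse Gramian factors through an antistable quotient pair, its compression
is the inverse of the infinite-horizon Gramian of that pair. -/
lemma IsControllable.compression_limit_inv_gramian (hAB : IsControllable A B)
    {L : Matrix (Fin n) (Fin n) ℂ} (hL : Tendsto (fun T => (gramian A B T)⁻¹) atTop (𝓝 L))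
    {R : Matrix (Fin p) (Fin n) ℂ} {V : Matrix (Fin n) (Fin p) ℂ} {J : Matrix (Fin p) (Fin p) ℂ}
    (hRV : R * V = 1) (hRA : R * A = J * R) (hLR : L = Rᴴ * (Vᴴ * L * V) * R)
    (hJ : IsJordanNormalForm J) (hre : ∀ j, 0 < (J j j).re) :
    IsUnit (Vᴴ * L * V) ∧ gramianInfty J (R * B) = (Vᴴ * L * V)⁻¹ := by
  set Lu := Vᴴ * L * V with hLu
  have hVR : Vᴴ * Rᴴ = 1 := by rw [← Matrix.conjTranspose_mul, hRV, Matrix.conjTranspose_one]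
  have hG := hJ.tendsto_gramian hre (R * B)
  have hunit : IsUnit Lu := by
    rw [← Matrix.mulVec_injective_iff_isUnit]
    refine (injective_iff_map_eq_zero (Matrix.mulVecLin Lu)).2 fun x hx => ?_
    rw [Matrix.mulVecLin_apply] at hx
    have hLV : L *ᵥ (V *ᵥ x) = 0 := by
      rw [hLR, Matrix.mulVec_mulVec, Matrix.mul_assoc _ R V, hRV, Matrix.mul_one,
        ← Matrix.mulVec_mulVec, hx, Matrix.mulVec_zero]
    have hpair : star (V *ᵥ x) ⬝ᵥ (Rᴴ *ᵥ x) = star x ⬝ᵥ x := by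
      rw [Matrix.star_mulVec, ← Matrix.dotProduct_mulVec, Matrix.mulVec_mulVec, hVR,
        Matrix.one_mulVec]
    have hquad : ∀ T, star (Rᴴ *ᵥ x) ⬝ᵥ gramian A B T *ᵥ (Rᴴ *ᵥ x) =
        star x ⬝ᵥ gramian J (R * B) T *ᵥ x := fun T => by
      rw [← gramian_of_intertwining hRA, Matrix.star_mulVec, Matrix.conjTranspose_conjTranspose,
        ← Matrix.dotProduct_mulVec, ← Matrix.mulVec_mulVec, ← Matrix.mulVec_mulVec]
    set b := (star x ⬝ᵥ gramianInfty J (R * B) *ᵥ x).re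
    set s := (star x ⬝ᵥ x).re with hs
    -- The square is completed at `V x` and `c R† x`; the term in `V x` vanishes in the limit
    -- because `L V x = 0`.
    have hineq : ∀ c : ℝ, 2 * (c * s) ≤ c ^ 2 * b := by
      intro c
      have hlim := (Matrix.tendsto_star_dotProduct hL (V *ᵥ x)).add
        ((Matrix.tendsto_star_dotProduct hG x).const_mul (c ^ 2))
      rw [hLV, dotProduct_zero, Complex.zero_re, zero_add] at hlim
      refine ge_of_tendsto hlim ?_
      filter_upwards [eventually_gt_atTop 0] with T hT
      have hle := (hAB.gramian_posDef hT).two_re_le (V *ᵥ x) ((c : ℂ) • (Rᴴ *ᵥ x))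
      simp only [dotProduct_smul, star_smul, smul_dotProduct, Matrix.mulVec_smul, smul_eq_mul,
        hpair, hquad, RCLike.star_def, Complex.conj_ofReal, Complex.re_ofReal_mul, ← hs,
        ← mul_assoc] at hle
      rw [← Complex.ofReal_mul, Complex.re_ofReal_mul] at hle
      rw [← mul_assoc, sq]
      exact hle
    have hs0 : s ≤ 0 := by
      by_contra hpos
      push Not at hpos
      -- This `c` turns the inequality into `2 s² ≤ s² b / (|b| + 1) ≤ s²`, whatever the sign of
      -- `b`.
      have hb := hineq (s / (|b| + 1))
      have hbpos : 0 < |b| + 1 := by positivity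
      have e1 : 2 * (s / (|b| + 1) * s) = 2 * s ^ 2 / (|b| + 1) := by ring
      have e2 : (s / (|b| + 1)) ^ 2 * b = s ^ 2 * (b / (|b| + 1)) / (|b| + 1) := by
        field_simp
      rw [e1, e2, div_le_div_iff_of_pos_right hbpos] at hb
      have hb1 : b / (|b| + 1) ≤ 1 := (div_le_one hbpos).2 (by linarith [le_abs_self b])
      nlinarith [sq_pos_of_pos hpos]
    have hnn := dotProduct_star_self_nonneg x
    rw [dotProduct_comm] at hnn
    rw [hs, dotProduct_comm] at hs0
    obtain ⟨hn1, hn2⟩ := Complex.le_def.1 hnn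
    refine dotProduct_star_self_eq_zero.1 ?_
    rw [dotProduct_comm]
    exact Complex.ext (le_antisymm hs0 hn1) hn2.symm
  refine ⟨hunit, ?_⟩
  have hdet := (Matrix.isUnit_iff_isUnit_det _).1 hunit
  have hfix : ∀ τ : ℝ, gramian J (R * B) τ +
      NormedSpace.exp (-(τ • J)) * Lu⁻¹ * (NormedSpace.exp (-(τ • J)))ᴴ = Lu⁻¹ := by
    intro τ
    set E := NormedSpace.exp (τ • J) with hE
    set F := NormedSpace.exp (-(τ • J)) with hF
    set M := Eᴴ * Lu * E with hM
    have hREA : R * NormedSpace.exp (τ • A) = E * R := Matrix.mul_exp_smul_eq hRA τ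
    have hMM : (NormedSpace.exp (τ • A))ᴴ * L * NormedSpace.exp (τ • A) = Rᴴ * M * R := by
      calc (NormedSpace.exp (τ • A))ᴴ * L * NormedSpace.exp (τ • A)
          = (R * NormedSpace.exp (τ • A))ᴴ * Lu * (R * NormedSpace.exp (τ • A)) := by
            conv_lhs => rw [hLR]
            simp only [Matrix.conjTranspose_mul, Matrix.mul_assoc]
        _ = Rᴴ * M * R := by
            rw [hREA, hM]
            simp only [Matrix.conjTranspose_mul, Matrix.mul_assoc]
    have hfixA := hAB.limit_inv_gramian_eq hL τ
    rw [hMM] at hfixA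
    -- The fixed-point equation for `L`, compressed by `V†` on the left and `V` on the right.
    have hLM : Lu * (gramian J (R * B) τ * M + 1) = M := by
      have h1 : Vᴴ * (Rᴴ * M * R) * V = M := by
        calc Vᴴ * (Rᴴ * M * R) * V = (Vᴴ * Rᴴ) * M * (R * V) := by
              simp only [Matrix.mul_assoc]
          _ = M := by rw [hVR, hRV, Matrix.one_mul, Matrix.mul_one]
      have h2 : Vᴴ * L = Lu * R := by
        conv_lhs => rw [hLR]
        rw [← Matrix.mul_assoc, ← Matrix.mul_assoc, hVR, Matrix.one_mul]
      refine Eq.trans ?_ h1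
      rw [← hfixA, ← Matrix.mul_assoc Vᴴ L, h2, ← gramian_of_intertwining hRA]
      calc Lu * (R * gramian A B τ * Rᴴ * M + 1)
          = Lu * (R * gramian A B τ * Rᴴ * M * (R * V) + R * V) := by rw [hRV, Matrix.mul_one]
        _ = _ := by simp only [Matrix.mul_add, Matrix.add_mul, Matrix.mul_assoc, Matrix.mul_one]
    have hX : gramian J (R * B) τ * M + 1 = Lu⁻¹ * M := by
      have := congrArg (fun Z => Lu⁻¹ * Z) hLM
      simp only [← Matrix.mul_assoc Lu⁻¹ Lu, Matrix.nonsing_inv_mul _ hdet, Matrix.one_mul] at this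
      exact this
    -- Multiplying `hX` by this inverse of `M` isolates the Gramian.
    have hMinv : M * (F * Lu⁻¹ * Fᴴ) = 1 := by
      calc M * (F * Lu⁻¹ * Fᴴ) = Eᴴ * Lu * (E * F) * Lu⁻¹ * Fᴴ := by
            rw [hM]; simp only [Matrix.mul_assoc]
        _ = Eᴴ * Fᴴ := by
            rw [hE, hF, Matrix.exp_smul_mul_exp_neg_smul, Matrix.mul_one, Matrix.mul_assoc _ Lu,
              Matrix.mul_nonsing_inv _ hdet, Matrix.mul_one]
        _ = 1 := by
            rw [← Matrix.conjTranspose_mul, hE, hF, Matrix.exp_neg_smul_mul_exp_smul,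
              Matrix.conjTranspose_one]
    have := congrArg (fun Z => Z * (F * Lu⁻¹ * Fᴴ)) hX
    simp only [Matrix.add_mul, Matrix.mul_assoc _ M, hMinv, Matrix.mul_one, Matrix.one_mul] at this
    exact this
  have hexp := hJ.tendsto_exp_neg hre
  have hcont : Continuous fun Z : Matrix (Fin p) (Fin p) ℂ => Z * Lu⁻¹ * Zᴴ :=
    (continuous_id.matrix_mul continuous_const).matrix_mul continuous_id.matrix_conjTranspose
  have hlim := hG.add ((hcont.tendsto 0).comp hexp)
  rw [Matrix.conjTranspose_zero, Matrix.mul_zero, add_zero] at hlim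
  exact tendsto_nhds_unique (hlim.congr hfix) tendsto_const_nhds

end Limit

/-- For a controllable pair `(A, B)` and any Jordan change of basis `P` as in the definition of `K`,
`W_{A,B}(T)⁻¹ → K` as `T → ∞`. The first three conjuncts say that the objects involved are well
defined: `W_{A,B}(T)` is invertible, the integral defining `W_u` converges, and `W_u` is invertible. -/
theorem theorem2 {n m : ℕ} (A : Matrix (Fin n) (Fin n) ℂ) (B : Matrix (Fin n) (Fin m) ℂ)
    (hAB : IsControllable A B)
    {nu ns : ℕ} (h : nu + ns = n) (P : Matrix (Fin n) (Fin n) ℂ)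
    (Ju : Matrix (Fin nu) (Fin nu) ℂ) (Js : Matrix (Fin ns) (Fin ns) ℂ)
    (hP : IsJordanSplitting h A P Ju Js) :
    (∀ T : ℝ, 0 < T → IsUnit (gramian A B T)) ∧
    (∀ i j : Fin nu, IntegrableOn
      (fun t : ℝ => gramianIntegrand Ju (topRows h (P⁻¹ * B)) t i j) (Set.Ioi 0)) ∧
    IsUnit (unstableGramian h P Ju B) ∧
    Tendsto (fun T : ℝ => (gramian A B T)⁻¹) atTop (𝓝 (limitK h P Ju B)) := by
  have hJu := hP.jordan.of_blockDiag₂_left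
  have hJs := hP.jordan.of_blockDiag₂_right
  have hu : ∀ j, 0 < (Ju j j).re := fun j => hP.unstable _ (hJu.diag_mem_spectrum j)
  have hs : ∀ j, (Js j j).re ≤ 0 := fun j => hP.nonpos _ (hJs.diag_mem_spectrum j)
  have hdet := (Matrix.isUnit_iff_isUnit_det P).1 hP.nonsingular
  obtain ⟨L, hL⟩ := hAB.exists_tendsto_inv_gramian
  have hLH : Lᴴ = L := hAB.isHermitian_of_tendsto_inv_gramian hL
  set R := topRows h P⁻¹ with hR
  set V := leftCols h P with hV
  have hAP : A * P = P * blockDiag₂ h Ju Js := by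
    rw [← hP.conj_eq, Matrix.mul_assoc, Matrix.mul_nonsing_inv_cancel_left _ _ hdet]
  have hPA : P⁻¹ * A = blockDiag₂ h Ju Js * P⁻¹ := by
    rw [← hP.conj_eq, Matrix.mul_nonsing_inv_cancel_right _ _ hdet]
  have hRV : R * V = 1 := by
    have : (P⁻¹ * P).submatrix (fun i => splitEquiv h (Sum.inl i))
        (fun i => splitEquiv h (Sum.inl i)) = (1 : Matrix (Fin nu) (Fin nu) ℂ) := by
      rw [Matrix.nonsing_inv_mul _ hdet]
      exact Matrix.submatrix_one _ ((splitEquiv h).injective.comp Sum.inl_injective)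
    exact this
  have hRA : R * A = Ju * R := by
    rw [hR, ← topRows_mul, hPA, topRows_blockDiag₂_mul]
  have hLU : L * rightCols h P = 0 := by
    refine hAB.limit_mul_eq_zero hL ?_ hJs hs
    rw [← rightCols_mul_blockDiag₂ h Ju Js, ← hAP]
    rfl
  -- `V R` is the projection onto the unstable subspace, and `L` kills the complementary one.
  have hLVR : L = L * V * R := by
    have h1 : P * P⁻¹ = V * R + rightCols h P * bottomRows h P⁻¹ :=
      mul_eq_leftCols_mul_topRows_add h P P⁻¹
    rw [Matrix.mul_nonsing_inv _ hdet] at h1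
    calc L = L * 1 := (Matrix.mul_one L).symm
      _ = L * V * R := by
        rw [h1, Matrix.mul_add, ← Matrix.mul_assoc, ← Matrix.mul_assoc, hLU, Matrix.zero_mul,
          add_zero]
  have hLR : L = Rᴴ * (Vᴴ * L * V) * R := by
    have h1 : L = Rᴴ * (Vᴴ * L) := by
      have := congrArg Matrix.conjTranspose hLVR
      rwa [Matrix.conjTranspose_mul, Matrix.conjTranspose_mul, hLH] at this
    calc L = L * V * R := hLVR
      _ = Rᴴ * (Vᴴ * L) * V * R := by rw [← h1]
      _ = _ := by simp only [Matrix.mul_assoc]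
  obtain ⟨hunit, hW⟩ := hAB.compression_limit_inv_gramian hL hRV hRA hLR hJu hu
  have hdetL := (Matrix.isUnit_iff_isUnit_det _).1 hunit
  have hWu : unstableGramian h P Ju B = (Vᴴ * L * V)⁻¹ := hW
  refine ⟨fun T hT => hAB.isUnit_gramian hT,
    fun i j => hJu.integrableOn_gramianIntegrand hu _ i j, ?_, ?_⟩
  · rw [hWu]
    exact (Matrix.isUnit_nonsing_inv_iff).2 hunit
  · have hK : limitK h P Ju B = L := by
      rw [limitK, hWu, Matrix.nonsing_inv_nonsing_inv _ hdetL, Matrix.mul_assoc,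
        mul_eq_leftCols_mul_topRows_add h, topRows_blockDiag₂_mul, bottomRows_blockDiag₂_mul,
        Matrix.zero_mul, Matrix.mul_zero, add_zero, ← Matrix.mul_assoc]
      exact hLR.symm
    rwa [hK]
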